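/- Let $\mathbb C_-$ be the open left half-plane and $\mathbb C_+=(\mathbb C\setminus\mathbb C_-)\cup\{\infty\}$. Let $\mathbb H$ be the ring of proper rational functions with real coefficients all of whose poles lie in $\mathbb C_-$. A compensator $K$ (an $m\times m$ real rational matrix) is said to stabilize an $m\times m$ real rational plant $P$ if $\det(I+KP)\not\equiv 0$ and the four closed-loop transfer matrices $(I+PK)^{-1}$, $P(I+KP)^{-1}$, $K(I+PK)^{-1}$, $(I+KP)^{-1}$ all have entries in $\mathbb H$. Let $P_0=N_0D_0^{-1}$ and $P_1=N_1D_1^{-1}$ be $m\times m$ plants, where $N_i,D_i\in\mathbb H^{m\times m}$, $\det D_i\not\equiv0$, and these representations are right coprime over $\mathbb H$, i.e. there are $X_i,Y_i\in\mathbb H^{m\times m}$ with $X_iN_i+Y_iD_i=I$ ($i=0,1$). Let $$M=\begin{bmatrix}N_0&N_1\\ D_0&D_1\end{bmatrix},$$ let $\operatorname{Adj}(M)$ be its adjugate matrix, and assume that $\det M(\infty)\neq0$ and that all zeros $s_1,\dots,s_t$ ($t\ge 0$) of $\det M$ in $\mathbb C_+$ are simple. Then there is a proper $m\times m$ compensator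 $K$ that stabilizes both $P_0$ and $P_1$ if and only if there exist $\Delta_0,\Delta_1\in\mathbb H^{m\times m}$ such that $\det\Delta_0$ and $\det\Delta_1$ are units of $\mathbb H$ and $$\begin{bmatrix}\Delta_0(s)&\Delta_1(s)\end{bmatrix}\operatorname{Adj}(M(s))=0\qquad\text{at } s=s_1,\dots,s_t .$$ -/

import Mathlib

namespace SimStab

open Polynomial

/-- A real rational function is proper if the degree of its numerator does not exceed the degree
of its denominator (both in lowest terms). -/
def IsProper (f : RatFunc ℝ) : Prop := f.num.natDegree ≤ f.denom.natDegree

/-- All (finite) poles of `f` lie in the open left half-plane. -/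
def PolesInLeftHalfPlane (f : RatFunc ℝ) : Prop :=
  ∀ s : ℂ, f.denom.eval₂ (algebraMap ℝ ℂ) s = 0 → s.re < 0

theorem isProper_iff (f : RatFunc ℝ) : IsProper f ↔ f.intDegree ≤ 0 := by
  unfold IsProper RatFunc.intDegree
  omega

theorem IsProper.add {f g : RatFunc ℝ} (hf : IsProper f) (hg : IsProper g) :
    IsProper (f + g) := by
  rw [isProper_iff] at *
  by_cases h0 : g = 0
  · simpa [h0] using hf
  by_cases h1 : f + g = 0
  · simp [h1]
  · exact (RatFunc.intDegree_add_le h0 h1).trans (max_le hf hg)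

theorem IsProper.mul {f g : RatFunc ℝ} (hf : IsProper f) (hg : IsProper g) :
    IsProper (f * g) := by
  rw [isProper_iff] at *
  by_cases h0 : f = 0
  · simp [h0]
  by_cases h1 : g = 0
  · simp [h1]
  rw [RatFunc.intDegree_mul h0 h1]
  omega

theorem PolesInLeftHalfPlane.of_dvd {f g h : RatFunc ℝ} (hf : PolesInLeftHalfPlane f)
    (hg : PolesInLeftHalfPlane g) (hd : h.denom ∣ f.denom * g.denom) :
    PolesInLeftHalfPlane h := by
  intro s hs
  obtain ⟨c, hc⟩ := hd
  have h0 : (f.denom * g.denom).eval₂ (algebraMap ℝ ℂ) s = 0 := by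
    rw [hc, eval₂_mul, hs, zero_mul]
  rw [eval₂_mul, mul_eq_zero] at h0
  exact h0.elim (hf s) (hg s)

theorem isProper_C (c : ℝ) : IsProper (RatFunc.C c) := by
  rw [isProper_iff, RatFunc.intDegree_C]

theorem polesInLeftHalfPlane_C (c : ℝ) : PolesInLeftHalfPlane (RatFunc.C c) := by
  intro s hs
  simp at hs

/-- The ring `ℍ` of proper real rational functions all of whose poles lie in the open left
half-plane. -/
def H : Subring (RatFunc ℝ) where
  carrier := {f | IsProper f ∧ PolesInLeftHalfPlane f}
  mul_mem' := fun hf hg => ⟨hf.1.mul hg.1, hf.2.of_dvd hg.2 (RatFunc.denom_mul_dvd _ _)⟩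
  one_mem' := by
    rw [← map_one RatFunc.C]
    exact ⟨isProper_C 1, polesInLeftHalfPlane_C 1⟩
  add_mem' := fun hf hg => ⟨hf.1.add hg.1, hf.2.of_dvd hg.2 (RatFunc.denom_add_dvd _ _)⟩
  zero_mem' := by
    rw [← map_zero RatFunc.C]
    exact ⟨isProper_C 0, polesInLeftHalfPlane_C 0⟩
  neg_mem' := by
    rintro f ⟨hf, hf'⟩
    have e : -f = RatFunc.C (-1) * f := by simp
    rw [e]
    exact ⟨(isProper_C _).mul hf,
      (polesInLeftHalfPlane_C _).of_dvd hf' (RatFunc.denom_mul_dvd _ _)⟩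

/-- The value `f(s)` of `f ∈ ℍ` at a complex number `s`
(used only for `0 ≤ re s`, where `f` has no pole). -/
noncomputable def evalAt (s : ℂ) (f : H) : ℂ := RatFunc.eval (algebraMap ℝ ℂ) s (f : RatFunc ℝ)

/-- The value `f(∞)` of the proper rational function `f`. -/
noncomputable def evalAtInfty (f : H) : ℝ :=
  (f : RatFunc ℝ).num.coeff (f : RatFunc ℝ).denom.natDegree / (f : RatFunc ℝ).denom.leadingCoeff

/-- The order of vanishing of `f ∈ ℍ`, `f ≠ 0`, at a complex number `s` that is not a pole of `f`:
the multiplicity of `s` as a root of the numerator of `f` in lowest terms. -/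
noncomputable def zeroOrder (s : ℂ) (f : H) : ℕ :=
  ((f : RatFunc ℝ).num.map (algebraMap ℝ ℂ)).rootMultiplicity s

/-- A matrix over `ℍ`, viewed as a matrix of rational functions. -/
def toRat {m : ℕ} (A : Matrix (Fin m) (Fin m) H) : Matrix (Fin m) (Fin m) (RatFunc ℝ) :=
  A.map (fun f => (f : RatFunc ℝ))

/-- The rational matrix `A` has all its entries in `ℍ`, i.e. it is a stable transfer matrix. -/
def IsStable {m : ℕ} (A : Matrix (Fin m) (Fin m) (RatFunc ℝ)) : Prop := ∀ i j, A i j ∈ H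

/-- Bézout right coprimeness over `ℍ`. -/
def RightCoprime {m : ℕ} (N D : Matrix (Fin m) (Fin m) H) : Prop :=
  ∃ X Y : Matrix (Fin m) (Fin m) H, X * N + Y * D = 1

/-- `N D⁻¹` is a right coprime representation over `ℍ` of the plant `P`. -/
def IsRightCoprimeRep {m : ℕ} (P : Matrix (Fin m) (Fin m) (RatFunc ℝ))
    (N D : Matrix (Fin m) (Fin m) H) : Prop :=
  D.det ≠ 0 ∧ RightCoprime N D ∧ P = toRat N * (toRat D)⁻¹

/-- The compensator `K` (internally) stabilizes the plant `P` in the negative feedback loop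
`e₁ = u₁ - P e₂`, `e₂ = u₂ + K e₁`: the loop is well posed, and the four closed-loop transfer
matrices from `(u₁, u₂)` to `(e₁, e₂)` are stable. -/
def Stabilizes {m : ℕ} (K P : Matrix (Fin m) (Fin m) (RatFunc ℝ)) : Prop :=
  (1 + K * P).det ≠ 0 ∧
    IsStable ((1 + P * K)⁻¹) ∧ IsStable (P * (1 + K * P)⁻¹) ∧
    IsStable (K * (1 + P * K)⁻¹) ∧ IsStable ((1 + K * P)⁻¹)

end SimStab

/-!
A compensator `K = Y⁻¹ X` stabilizes `N D⁻¹` exactly when `X N + Y D` is unimodular over `ℍ`, for a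
suitable representation of `K`. Writing `Δᵢ = X Nᵢ + Y Dᵢ`, simultaneous stabilization of the two
plants asks for unimodular `Δ₀, Δ₁` and matrices `X, Y` over `ℍ` with `[X Y] M = [Δ₀ Δ₁]`.

If `K` stabilizes both plants, normalizing `[X Y]` by the Bézout identity `X N₀ + Y D₀ = 1`
(`Stabilizes.exists_bezout`) makes `X N₁ + Y D₁` unimodular
(`exists_isUnit_det_of_stabilizes`), and `[Δ₀ Δ₁] Adj(M) = det M • [X Y]` vanishes at the zeros
of `det M`.

Conversely, if `[Δ₀ Δ₁] Adj(M)` vanishes at the zeros of `det M`, which are simple and not at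
infinity, then `det M` divides all its entries in `ℍ` (`dvd_of_evalAt_eq_zero`), which yields
`[X Y]` over `ℍ` with `[X Y] M = [Δ₀ Δ₁]`. However, `Y` may be singular, or `Y⁻¹ X` improper. This is
repaired by replacing `Y` with `Y + ε`, which changes `Δᵢ` to `Δᵢ + ε Dᵢ`. Elements of `ℍ` are
bounded on the closed right half-plane, so unimodularity is an open condition
(`eventually_isUnit_det_add`) and survives for small `ε`; and `Y + ε` is invertible at infinity
for all but finitely many `ε` (`finite_evalAtInfty_det_add_eq_zero`), which makes
`(Y + ε)⁻¹ X` proper.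
-/

namespace SimStab

open Polynomial Filter Topology Bornology

/-! ### Evaluation on the closed right half-plane and at infinity -/

theorem denom_eval_ne_zero (f : H) {s : ℂ} (hs : 0 ≤ s.re) :
    (f : RatFunc ℝ).denom.eval₂ (algebraMap ℝ ℂ) s ≠ 0 :=
  fun h => (f.2.2 s h).not_ge hs

/-- Evaluation at a point of the closed right half-plane, as a ring homomorphism. -/
noncomputable def evalHom (s : ℂ) (hs : 0 ≤ s.re) : H →+* ℂ where
  toFun := evalAt s
  map_one' := by simp [evalAt]
  map_zero' := by simp [evalAt]
  map_mul' f g := RatFunc.eval_mul _ _ (denom_eval_ne_zero f hs) (denom_eval_ne_zero g hs)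
  map_add' f g := RatFunc.eval_add _ _ (denom_eval_ne_zero f hs) (denom_eval_ne_zero g hs)

@[simp] theorem evalHom_apply (s : ℂ) (hs : 0 ≤ s.re) (f : H) : evalHom s hs f = evalAt s f := rfl

theorem evalAt_eq (s : ℂ) (f : H) :
    evalAt s f = ((f : RatFunc ℝ).num.map (algebraMap ℝ ℂ)).eval s /
      ((f : RatFunc ℝ).denom.map (algebraMap ℝ ℂ)).eval s := by
  simp [evalAt, RatFunc.eval, eval₂_eq_eval_map]

/-- The value at infinity of a proper quotient `p / q` is the coefficient of `p` in degree
`natDegree q`, divided by the leading coefficient of `q`; it is `0` when `p / q` is strictly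
proper. -/
theorem tendsto_div_cobounded {𝕜 : Type*} [NormedField 𝕜] {p q : 𝕜[X]} (hq : q ≠ 0)
    (h : p.natDegree ≤ q.natDegree) :
    Tendsto (fun z => p.eval z / q.eval z) (cobounded 𝕜)
      (𝓝 (p.coeff q.natDegree / q.leadingCoeff)) := by
  set c := p.coeff q.natDegree / q.leadingCoeff with hc
  have hlc : q.leadingCoeff ≠ 0 := leadingCoeff_ne_zero.mpr hq
  -- Subtracting `c • q` from `p` cancels the coefficient of degree `natDegree q`.
  have hdeg : (p - C c * q).degree < q.degree := by
    rw [degree_eq_natDegree hq, degree_lt_iff_coeff_zero]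
    intro k hk
    rcases hk.eq_or_lt with rfl | hk
    · rw [coeff_sub, coeff_C_mul, ← leadingCoeff, hc, div_mul_cancel₀ _ hlc, sub_self]
    · rw [coeff_sub, coeff_C_mul, coeff_eq_zero_of_natDegree_lt hk,
        coeff_eq_zero_of_natDegree_lt (h.trans_lt hk), mul_zero, sub_zero]
  have hlim := ((isLittleO_cobounded_of_degree_lt hdeg).tendsto_div_nhds_zero).add_const c
  rw [zero_add] at hlim
  have hne : ∀ᶠ z in cobounded 𝕜, q.eval z ≠ 0 :=
    (eventually_cofinite_not_isRoot hq).filter_mono (le_cofinite 𝕜)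
  refine hlim.congr' (hne.mono fun z hz => ?_)
  simp only [eval_sub, eval_mul, eval_C]
  field_simp
  ring

theorem tendsto_evalAt_cobounded (f : H) :
    Tendsto (fun z => evalAt z f) (cobounded ℂ) (𝓝 (evalAtInfty f : ℂ)) := by
  have hq : (f : RatFunc ℝ).denom.map (algebraMap ℝ ℂ) ≠ 0 :=
    (Polynomial.map_ne_zero_iff (algebraMap ℝ ℂ).injective).mpr (RatFunc.denom_ne_zero _)
  have h := tendsto_div_cobounded (p := (f : RatFunc ℝ).num.map (algebraMap ℝ ℂ)) hq
    (by simpa using show _ ≤ _ from f.2.1)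
  simpa [evalAt_eq, evalAtInfty] using h

theorem tendsto_evalAt_atTop (f : H) :
    Tendsto (fun x : ℝ => evalAt x f) atTop (𝓝 (evalAtInfty f : ℂ)) :=
  (tendsto_evalAt_cobounded f).comp (RCLike.tendsto_ofReal_atTop_cobounded ℂ)

theorem evalAtInfty_eq_of_tendsto {f : H} {c : ℝ}
    (h : Tendsto (fun x : ℝ => evalAt x f) atTop (𝓝 (c : ℂ))) : evalAtInfty f = c :=
  Complex.ofReal_injective (tendsto_nhds_unique (tendsto_evalAt_atTop f) h)

/-- Evaluation at infinity, as a ring homomorphism. Being a limit of the evaluations at positive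
reals, it inherits their multiplicativity and additivity. -/
noncomputable def evalInftyHom : H →+* ℝ where
  toFun := evalAtInfty
  map_one' := by simp [evalAtInfty]
  map_zero' := by simp [evalAtInfty]
  map_mul' f g := by
    refine evalAtInfty_eq_of_tendsto ?_
    push_cast
    refine ((tendsto_evalAt_atTop f).mul (tendsto_evalAt_atTop g)).congr' ?_
    filter_upwards [eventually_ge_atTop 0] with x hx
    exact (map_mul (evalHom x (by simpa using hx)) f g).symm
  map_add' f g := by
    refine evalAtInfty_eq_of_tendsto ?_
    push_cast
    refine ((tendsto_evalAt_atTop f).add (tendsto_evalAt_atTop g)).congr' ?_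
    filter_upwards [eventually_ge_atTop 0] with x hx
    exact (map_add (evalHom x (by simpa using hx)) f g).symm

@[simp] theorem evalInftyHom_apply (f : H) : evalInftyHom f = evalAtInfty f := rfl

/-- The constant functions in `ℍ`. -/
noncomputable def const (c : ℝ) : H := ⟨RatFunc.C c, isProper_C c, polesInLeftHalfPlane_C c⟩

@[simp] theorem evalAt_const (s : ℂ) (c : ℝ) : evalAt s (const c) = c := by
  simp [evalAt, const]

@[simp] theorem evalAtInfty_const (c : ℝ) : evalAtInfty (const c) = c :=
  evalAtInfty_eq_of_tendsto (by simp)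

/-- An element of `ℍ` is bounded on the closed right half-plane: it is continuous there and has a
limit at infinity. -/
theorem exists_norm_evalAt_le (f : H) : ∃ C : ℝ, ∀ s : ℂ, 0 ≤ s.re → ‖evalAt s f‖ ≤ C := by
  have hev : ∀ᶠ z in cobounded ℂ, ‖evalAt z f‖ < ‖(evalAtInfty f : ℂ)‖ + 1 :=
    (tendsto_evalAt_cobounded f).norm.eventually_lt_const (lt_add_one _)
  obtain ⟨R, -, hR⟩ := (hasBasis_cobounded_norm (E := ℂ)).eventually_iff.mp hev
  have hK : IsCompact (Metric.closedBall (0 : ℂ) R ∩ {z | 0 ≤ z.re}) :=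
    (isCompact_closedBall 0 R).inter_right (isClosed_le continuous_const Complex.continuous_re)
  have hc : ContinuousOn (fun z => evalAt z f)
      (Metric.closedBall (0 : ℂ) R ∩ {z | 0 ≤ z.re}) := by
    simp only [evalAt_eq]
    refine (Polynomial.continuousOn _).div (Polynomial.continuousOn _) fun z hz => ?_
    rw [← eval₂_eq_eval_map]
    exact denom_eval_ne_zero f hz.2
  obtain ⟨C, hC⟩ := hK.exists_bound_of_continuousOn hc
  refine ⟨max C (‖(evalAtInfty f : ℂ)‖ + 1), fun s hs => ?_⟩
  rcases le_total ‖s‖ R with h | h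
  · exact (hC s ⟨by simpa using h, hs⟩).trans (le_max_left _ _)
  · exact (hR h).le.trans (le_max_right _ _)

/-! ### Divisibility and units in `ℍ` -/

theorem evalAt_eq_zero_iff (f : H) {s : ℂ} (hs : 0 ≤ s.re) :
    evalAt s f = 0 ↔ ((f : RatFunc ℝ).num.map (algebraMap ℝ ℂ)).IsRoot s := by
  rw [evalAt_eq, div_eq_zero_iff, IsRoot.def, or_iff_left]
  rw [← eval₂_eq_eval_map]
  exact denom_eval_ne_zero f hs

theorem intDegree_eq_zero_of_evalAtInfty_ne_zero {f : H} (h : evalAtInfty f ≠ 0) :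
    (f : RatFunc ℝ).intDegree = 0 := by
  have h1 : (f : RatFunc ℝ).num.coeff (f : RatFunc ℝ).denom.natDegree ≠ 0 := by
    intro h0
    simp [evalAtInfty, h0] at h
  have h2 := le_natDegree_of_ne_zero h1
  have h3 := f.2.1
  unfold IsProper at h3
  unfold RatFunc.intDegree
  omega

theorem ne_zero_of_evalAtInfty_ne_zero {f : H} (h : evalAtInfty f ≠ 0) : f ≠ 0 := by
  rintro rfl
  exact h (map_zero evalInftyHom)

/-- If `d` is nonzero at infinity and has only simple zeros in the closed right half-plane, then
`d` divides every `h` vanishing at these zeros. -/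
theorem dvd_of_evalAt_eq_zero {d h : H} (hd : evalAtInfty d ≠ 0)
    (hsimple : ∀ s : ℂ, 0 ≤ s.re → evalAt s d = 0 → zeroOrder s d ≤ 1 ∧ evalAt s h = 0) :
    d ∣ h := by
  rcases eq_or_ne h 0 with rfl | hh
  · exact dvd_zero d
  have hd0 : (d : RatFunc ℝ) ≠ 0 := by
    simpa using ne_zero_of_evalAtInfty_ne_zero hd
  have hh0 : (h : RatFunc ℝ) ≠ 0 := by simpa using hh
  set q : RatFunc ℝ := h / d with hq
  have hmul : (d : RatFunc ℝ) * q = h := mul_div_cancel₀ _ hd0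
  have hq0 : q ≠ 0 := div_ne_zero hh0 hd0
  suffices hqH : q ∈ H from ⟨⟨q, hqH⟩, Subtype.ext hmul.symm⟩
  constructor
  · rw [isProper_iff, hq, RatFunc.intDegree_div hh0 hd0,
      intDegree_eq_zero_of_evalAtInfty_ne_zero hd, sub_zero]
    exact (isProper_iff _).mp h.2.1
  intro s hs
  by_contra hre
  rw [not_lt] at hre
  let φ := algebraMap ℝ ℂ
  have hne : ∀ {p : ℝ[X]}, p ≠ 0 → p.map φ ≠ 0 := fun hp =>
    (Polynomial.map_ne_zero_iff φ.injective).mpr hp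
  have hroot : ∀ f : H, ¬ ((f : RatFunc ℝ).denom.map φ).IsRoot s := fun f => by
    rw [IsRoot.def, ← eval₂_eq_eval_map]
    exact denom_eval_ne_zero f hre
  have hqd : ((RatFunc.denom q).map φ).IsRoot s := by
    rw [IsRoot.def, ← eval₂_eq_eval_map]
    exact hs
  have hqn : ¬ ((RatFunc.num q).map φ).IsRoot s := by
    intro hn
    obtain ⟨a, b, hab⟩ := (RatFunc.isCoprime_num_denom q).map (mapRingHom φ)
    have := congrArg (eval s) hab
    simp only [coe_mapRingHom, eval_add, eval_mul, hn.eq_zero, hqd.eq_zero] at this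
    simp at this
  -- Compare the multiplicities of `s` on both sides of `d * q = h`, cleared of denominators.
  have key := RatFunc.num_denom_mul (d : RatFunc ℝ) q
  rw [hmul] at key
  have key' := congrArg (fun p => (p.map φ).rootMultiplicity s) key
  have hhn := hne (RatFunc.num_ne_zero hh0)
  have hdn := hne (RatFunc.num_ne_zero hd0)
  have hqn0 := hne (RatFunc.num_ne_zero hq0)
  have hhd := hne (RatFunc.denom_ne_zero (h : RatFunc ℝ))
  have hdd := hne (RatFunc.denom_ne_zero (d : RatFunc ℝ))
  have hqd0 := hne (RatFunc.denom_ne_zero q)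
  simp only [Polynomial.map_mul] at key'
  rw [rootMultiplicity_mul (mul_ne_zero hhn (mul_ne_zero hdd hqd0)),
    rootMultiplicity_mul (mul_ne_zero hdd hqd0),
    rootMultiplicity_mul (mul_ne_zero (mul_ne_zero hdn hqn0) hhd),
    rootMultiplicity_mul (mul_ne_zero hdn hqn0), rootMultiplicity_eq_zero hqn,
    rootMultiplicity_eq_zero (hroot d), rootMultiplicity_eq_zero (hroot h)] at key'
  have h1 : 0 < ((RatFunc.denom q).map φ).rootMultiplicity s :=
    (rootMultiplicity_pos hqd0).mpr hqd
  have h2 : 0 < ((d : RatFunc ℝ).num.map φ).rootMultiplicity s := by omega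
  obtain ⟨h3, h4⟩ := hsimple s hre
    ((evalAt_eq_zero_iff d hre).mpr ((rootMultiplicity_pos hdn).mp h2))
  have h5 := (rootMultiplicity_pos hhn).mpr ((evalAt_eq_zero_iff h hre).mp h4)
  change ((d : RatFunc ℝ).num.map φ).rootMultiplicity s ≤ 1 at h3
  omega

/-- An element of `ℍ` without zeros in the closed right half-plane or at infinity is a unit. -/
theorem isUnit_of_evalAt_ne_zero {f : H} (hinf : evalAtInfty f ≠ 0)
    (h : ∀ s : ℂ, 0 ≤ s.re → evalAt s f ≠ 0) : IsUnit f :=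
  isUnit_of_dvd_one (dvd_of_evalAt_eq_zero hinf fun s hs h0 => absurd h0 (h s hs))

/-! ### Perturbation of unimodular matrices -/

section Perturbation

variable {n : Type*} [Fintype n] [DecidableEq n]

/-- Small perturbations of the identity are unimodular: the determinant of a complex matrix is
continuous at `1`, and `B` is uniformly bounded on the closed right half-plane. -/
theorem eventually_isUnit_det_one_add (B : Matrix n n H) :
    ∀ᶠ ε : ℝ in 𝓝 0, IsUnit (1 + const ε • B).det := by
  have hdet : ∀ᶠ A : Matrix n n ℂ in 𝓝 0, 1 / 2 < ‖(1 + A).det‖ := by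
    have hc : Continuous fun A : Matrix n n ℂ => ‖(1 + A).det‖ := by fun_prop
    have h := hc.tendsto 0
    rw [add_zero, Matrix.det_one, norm_one] at h
    exact h.eventually_const_lt (by norm_num)
  have hbd : ∃ C : ℝ, ∀ s : ℂ, 0 ≤ s.re → ∀ i j, ‖evalAt s (B i j)‖ ≤ C := by
    choose C hC using fun i j => exists_norm_evalAt_le (B i j)
    refine ⟨∑ i, ∑ j, |C i j|, fun s hs i j => ((hC i j s hs).trans (le_abs_self _)).trans ?_⟩
    exact (Finset.single_le_sum (f := fun j => |C i j|) (fun _ _ => abs_nonneg _)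
      (Finset.mem_univ j)).trans (Finset.single_le_sum (f := fun i => ∑ j, |C i j|)
        (fun _ _ => Finset.sum_nonneg fun _ _ => abs_nonneg _) (Finset.mem_univ i))
  obtain ⟨C, hC⟩ := hbd
  have hunif : ∀ᶠ ε : ℝ in 𝓝 0, ∀ s : ℂ, 0 ≤ s.re →
      1 / 2 < ‖evalAt s (1 + const ε • B).det‖ := by
    obtain ⟨r, hr, hball⟩ : ∃ r > 0, ∀ A : Matrix n n ℂ, (∀ i j, ‖A i j‖ < r) →
        1 / 2 < ‖(1 + A).det‖ := by
      let _ : NormedAddCommGroup (Matrix n n ℂ) := Matrix.normedAddCommGroup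
      obtain ⟨r, hr, hb⟩ := Metric.eventually_nhds_iff.mp hdet
      refine ⟨r, hr, fun A hA => hb ?_⟩
      rw [dist_zero_right]
      exact (Matrix.norm_lt_iff hr).mpr hA
    have hε : ∀ᶠ ε : ℝ in 𝓝 0, |ε| * C < r := by
      have hc : Continuous fun ε : ℝ => |ε| * C := by fun_prop
      exact (hc.tendsto 0).eventually_lt_const (by simpa using hr)
    filter_upwards [hε] with ε hε s hs
    have he := (evalHom s hs).map_det (1 + const ε • B)
    rw [evalHom_apply, map_add, map_one] at he
    rw [he]
    refine hball _ fun i j => ?_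
    simp only [RingHom.mapMatrix_apply, Matrix.map_apply, Matrix.smul_apply, smul_eq_mul, map_mul,
      evalHom_apply, evalAt_const, norm_mul, Complex.norm_real, Real.norm_eq_abs]
    exact (mul_le_mul_of_nonneg_left (hC s hs i j) (abs_nonneg _)).trans_lt hε
  filter_upwards [hunif] with ε hε
  refine isUnit_of_evalAt_ne_zero (fun h0 => ?_) fun s hs h0 => ?_
  -- The lower bound on the positive real axis passes to the limit at infinity.
  · have hlim := (tendsto_evalAt_atTop (1 + const ε • B).det).norm
    rw [h0, Complex.ofReal_zero, norm_zero] at hlim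
    have := ge_of_tendsto hlim (b := 1 / 2) (by
      filter_upwards [eventually_ge_atTop 0] with x hx
      exact (hε x (by simpa using hx)).le)
    norm_num at this
  · have := hε s hs
    rw [h0, norm_zero] at this
    norm_num at this

/-- Unimodularity is an open condition. -/
theorem eventually_isUnit_det_add {A : Matrix n n H} (hA : IsUnit A.det) (B : Matrix n n H) :
    ∀ᶠ ε : ℝ in 𝓝 0, IsUnit (A + const ε • B).det := by
  filter_upwards [eventually_isUnit_det_one_add (A⁻¹ * B)] with ε hε
  have : A + const ε • B = A * (1 + const ε • (A⁻¹ * B)) := by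
    rw [mul_add, mul_one, Matrix.mul_smul, Matrix.mul_nonsing_inv_cancel_left _ _ hA]
  rw [this, Matrix.det_mul]
  exact hA.mul hε

/-- For all but finitely many `ε`, the matrix `Y + ε` is invertible at infinity. -/
theorem finite_evalAtInfty_det_add_eq_zero (Y : Matrix n n H) :
    {ε : ℝ | evalAtInfty (Y + const ε • (1 : Matrix n n H)).det = 0}.Finite := by
  have hfin := finite_setOfPred_isRoot (Matrix.charpoly_monic (-evalInftyHom.mapMatrix Y)).ne_zero
  refine hfin.subset fun ε hε => ?_
  have he := evalInftyHom.map_det (Y + const ε • (1 : Matrix n n H))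
  rw [evalInftyHom_apply, show evalAtInfty _ = 0 from hε] at he
  change eval ε _ = 0
  rw [Matrix.eval_charpoly, sub_neg_eq_add, he, map_add, add_comm]
  congr 2
  ext i j
  rcases eq_or_ne i j with rfl | hij
  · simp
  · simpa [hij] using (map_zero evalInftyHom).symm

end Perturbation

/-! ### Stabilization of one plant -/

variable {m : ℕ}

theorem toRat_mul (A B : Matrix (Fin m) (Fin m) H) : toRat (A * B) = toRat A * toRat B :=
  map_mul H.subtype.mapMatrix A B

theorem toRat_add (A B : Matrix (Fin m) (Fin m) H) : toRat (A + B) = toRat A + toRat B :=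
  map_add H.subtype.mapMatrix A B

theorem toRat_sub (A B : Matrix (Fin m) (Fin m) H) : toRat (A - B) = toRat A - toRat B :=
  map_sub H.subtype.mapMatrix A B

theorem toRat_one : toRat (1 : Matrix (Fin m) (Fin m) H) = 1 :=
  map_one H.subtype.mapMatrix

theorem toRat_injective : Function.Injective (toRat (m := m)) :=
  Matrix.map_injective Subtype.val_injective

theorem det_toRat (A : Matrix (Fin m) (Fin m) H) : (toRat A).det = (A.det : RatFunc ℝ) :=
  (H.subtype.map_det A).symm

theorem isUnit_det_toRat {A : Matrix (Fin m) (Fin m) H} (h : A.det ≠ 0) :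
    IsUnit (toRat A).det := by
  rw [det_toRat, isUnit_iff_ne_zero]
  simpa using h

theorem isStable_toRat (A : Matrix (Fin m) (Fin m) H) : IsStable (toRat A) :=
  fun i j => (A i j).2

theorem IsStable.exists_toRat_eq {A : Matrix (Fin m) (Fin m) (RatFunc ℝ)} (h : IsStable A) :
    ∃ B, toRat B = A :=
  ⟨fun i j => ⟨A i j, h i j⟩, rfl⟩

theorem toRat_inv {A : Matrix (Fin m) (Fin m) H} (h : IsUnit A.det) :
    toRat A⁻¹ = (toRat A)⁻¹ := by
  refine (Matrix.inv_eq_right_inv ?_).symm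
  rw [← toRat_mul, Matrix.mul_nonsing_inv _ h, toRat_one]

section PushThrough

variable {n R : Type*} [Fintype n] [DecidableEq n] [CommRing R] {K P : Matrix n n R}

/-- The push-through identity: `(1 + K P)⁻¹` determines `(1 + P K)⁻¹`. -/
theorem one_add_mul_inv_eq_sub (h : IsUnit (1 + K * P).det) :
    (1 + P * K)⁻¹ = 1 - P * (1 + K * P)⁻¹ * K := by
  refine Matrix.inv_eq_right_inv ?_
  have h1 : (1 + P * K) * P = P * (1 + K * P) := by noncomm_ring
  calc (1 + P * K) * (1 - P * (1 + K * P)⁻¹ * K)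
      = 1 + P * K - (1 + P * K) * P * (1 + K * P)⁻¹ * K := by noncomm_ring
    _ = 1 := by
      rw [h1, Matrix.mul_nonsing_inv_cancel_right _ _ h, add_sub_cancel_right]

theorem mul_one_add_mul_inv (h : IsUnit (1 + K * P).det) :
    K * (1 + P * K)⁻¹ = (1 + K * P)⁻¹ * K := by
  have h' : IsUnit (1 + P * K).det := by rwa [Matrix.det_one_add_mul_comm]
  calc K * (1 + P * K)⁻¹
      = (1 + K * P)⁻¹ * ((1 + K * P) * K) * (1 + P * K)⁻¹ := by
        rw [Matrix.nonsing_inv_mul_cancel_left _ _ h]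
    _ = (1 + K * P)⁻¹ * (K * (1 + P * K)) * (1 + P * K)⁻¹ := by
        congr 2
        noncomm_ring
    _ = (1 + K * P)⁻¹ * K := by
        rw [← Matrix.mul_assoc, Matrix.mul_nonsing_inv_cancel_right _ _ h']

end PushThrough

/-- A compensator stabilizing `N D⁻¹` has a fractional representation `Y⁻¹ X` over `ℍ`, normalized
by the Bézout identity `X N + Y D = 1`. -/
theorem Stabilizes.exists_bezout {K P : Matrix (Fin m) (Fin m) (RatFunc ℝ)}
    {N D : Matrix (Fin m) (Fin m) H} (hK : Stabilizes K P) (hP : IsRightCoprimeRep P N D) :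
    ∃ X Y : Matrix (Fin m) (Fin m) H, X * N + Y * D = 1 ∧ Y.det ≠ 0 ∧ toRat X = toRat Y * K := by
  obtain ⟨hdet, h11, h21, h12, h22⟩ := hK
  obtain ⟨hD, ⟨A, B, hAB⟩, hPeq⟩ := hP
  have hu : IsUnit (1 + K * P).det := isUnit_iff_ne_zero.mpr hdet
  have hDu := isUnit_det_toRat hD
  rw [mul_one_add_mul_inv hu] at h12
  obtain ⟨S, hS⟩ := h11.exists_toRat_eq
  obtain ⟨T, hT⟩ := h21.exists_toRat_eq
  obtain ⟨U, hU⟩ := h12.exists_toRat_eq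
  obtain ⟨W, hW⟩ := h22.exists_toRat_eq
  rw [one_add_mul_inv_eq_sub hu] at hS
  have hPD : P * toRat D = toRat N := by
    rw [hPeq, Matrix.nonsing_inv_mul_cancel_right _ _ hDu]
  -- The Bézout identity turns `D⁻¹` into `A P + B`, so `D⁻¹ (1 + K P)⁻¹` is stable.
  have hDinv : (toRat D)⁻¹ = toRat A * P + toRat B := by
    refine Matrix.inv_eq_left_inv ?_
    rw [add_mul, Matrix.mul_assoc, hPD, ← toRat_mul, ← toRat_mul, ← toRat_add, hAB, toRat_one]
  have hY : toRat (A * T + B * W) = (toRat D)⁻¹ * (1 + K * P)⁻¹ := by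
    rw [toRat_add, toRat_mul, toRat_mul, hT, hW, hDinv]
    noncomm_ring
  have hX : toRat (A * (1 - S) + B * U) = toRat (A * T + B * W) * K := by
    rw [hY, toRat_add, toRat_mul, toRat_mul, toRat_sub, toRat_one, hS, hU, hDinv]
    noncomm_ring
  refine ⟨A * (1 - S) + B * U, A * T + B * W, toRat_injective ?_, fun h0 => ?_, hX⟩
  · rw [toRat_add, toRat_mul, toRat_mul, hX, toRat_one, ← hPD]
    calc toRat (A * T + B * W) * K * (P * toRat D) + toRat (A * T + B * W) * toRat D
        = toRat (A * T + B * W) * (1 + K * P) * toRat D := by noncomm_ring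
      _ = 1 := by
        rw [hY, Matrix.nonsing_inv_mul_cancel_right _ _ hu, Matrix.nonsing_inv_mul _ hDu]
  · have h1 := congrArg Matrix.det hY
    rw [det_toRat, h0, Matrix.det_mul] at h1
    have h2 := (Matrix.isUnit_nonsing_inv_det _ hDu).mul (Matrix.isUnit_nonsing_inv_det _ hu)
    rw [← h1] at h2
    simp at h2

/-- If `Y⁻¹ X` is a compensator with `X N + Y D` unimodular, it stabilizes `N D⁻¹`. -/
theorem stabilizes_of_isUnit_det {P : Matrix (Fin m) (Fin m) (RatFunc ℝ)}
    {N D X Y : Matrix (Fin m) (Fin m) H} (hD : D.det ≠ 0) (hP : P = toRat N * (toRat D)⁻¹)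
    (hY : Y.det ≠ 0) (hΔ : IsUnit (X * N + Y * D).det) :
    Stabilizes ((toRat Y)⁻¹ * toRat X) P := by
  have hDu := isUnit_det_toRat hD
  have hYu := isUnit_det_toRat hY
  have hΔu := isUnit_det_toRat hΔ.ne_zero
  set Δ := X * N + Y * D with hΔdef
  set K := (toRat Y)⁻¹ * toRat X with hK
  have hKP : 1 + K * P = (toRat Y)⁻¹ * toRat Δ * (toRat D)⁻¹ := by
    have h1 : (toRat Y)⁻¹ * (toRat Y * toRat D) * (toRat D)⁻¹ = 1 := by
      rw [Matrix.nonsing_inv_mul_cancel_left _ _ hYu, Matrix.mul_nonsing_inv _ hDu]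
    rw [hΔdef, toRat_add, toRat_mul, toRat_mul, mul_add, add_mul, h1, hK, hP]
    noncomm_ring
  have hPD : P * toRat D = toRat N := by
    rw [hP, Matrix.nonsing_inv_mul_cancel_right _ _ hDu]
  have hYK : toRat Y * K = toRat X := by
    rw [hK, Matrix.mul_nonsing_inv_cancel_left _ _ hYu]
  have hu : IsUnit (1 + K * P).det := by
    rw [hKP, Matrix.det_mul, Matrix.det_mul]
    exact ((Matrix.isUnit_nonsing_inv_det _ hYu).mul hΔu).mul
      (Matrix.isUnit_nonsing_inv_det _ hDu)
  have hinv : (1 + K * P)⁻¹ = toRat (D * Δ⁻¹ * Y) := by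
    rw [hKP, Matrix.mul_inv_rev, Matrix.mul_inv_rev, Matrix.nonsing_inv_nonsing_inv _ hYu,
      Matrix.nonsing_inv_nonsing_inv _ hDu, toRat_mul, toRat_mul, toRat_inv hΔ, Matrix.mul_assoc]
  have hPinv : P * (1 + K * P)⁻¹ = toRat (N * Δ⁻¹ * Y) := by
    simp only [hinv, toRat_mul, ← hPD, Matrix.mul_assoc]
  have hinvK : (1 + K * P)⁻¹ * K = toRat (D * Δ⁻¹ * X) := by
    simp only [hinv, toRat_mul, ← hYK, Matrix.mul_assoc]
  have hPinvK : 1 - P * (1 + K * P)⁻¹ * K = toRat (1 - N * Δ⁻¹ * X) := by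
    simp only [hPinv, toRat_sub, toRat_one, toRat_mul, ← hYK, Matrix.mul_assoc]
  refine ⟨hu.ne_zero, ?_, ?_, ?_, ?_⟩
  · rw [one_add_mul_inv_eq_sub hu, hPinvK]
    exact isStable_toRat _
  · rw [hPinv]
    exact isStable_toRat _
  · rw [mul_one_add_mul_inv hu, hinvK]
    exact isStable_toRat _
  · rw [hinv]
    exact isStable_toRat _

/-- `Y⁻¹ X` is proper as soon as `Y` is invertible at infinity. -/
theorem isProper_inv_mul {X Y : Matrix (Fin m) (Fin m) H} (hY : evalAtInfty Y.det ≠ 0)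
    (i j : Fin m) : IsProper (((toRat Y)⁻¹ * toRat X) i j) := by
  have hadj : (toRat Y).adjugate = toRat Y.adjugate := (H.subtype.map_adjugate Y).symm
  have hdet : IsProper (Y.det : RatFunc ℝ)⁻¹ := by
    rw [isProper_iff, RatFunc.intDegree_inv, intDegree_eq_zero_of_evalAtInfty_ne_zero hY, neg_zero]
  rw [Matrix.inv_def, det_toRat, hadj, Ring.inverse_eq_inv', Matrix.smul_mul, ← toRat_mul,
    Matrix.smul_apply, smul_eq_mul]
  exact hdet.mul ((Y.adjugate * X) i j).2.1

/-! ### Stabilization of two plants -/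

/-- If `K` stabilizes both plants and `Y⁻¹ X` is its representation normalized by
`X N₀ + Y D₀ = 1`, then `X N₁ + Y D₁` is unimodular. -/
theorem exists_isUnit_det_of_stabilizes
    {K P₀ P₁ : Matrix (Fin m) (Fin m) (RatFunc ℝ)}
    {N₀ D₀ N₁ D₁ : Matrix (Fin m) (Fin m) H}
    (hP₀ : IsRightCoprimeRep P₀ N₀ D₀)
    (hP₁ : IsRightCoprimeRep P₁ N₁ D₁)
    (h₀ : Stabilizes K P₀) (h₁ : Stabilizes K P₁) :
    ∃ X Y : Matrix (Fin m) (Fin m) H, X * N₀ + Y * D₀ = 1 ∧ IsUnit (X * N₁ + Y * D₁).det := by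
  obtain ⟨X, Y, h, hY, hX⟩ := h₀.exists_bezout hP₀
  obtain ⟨X', Y', h', -, hX'⟩ := h₁.exists_bezout hP₁
  refine ⟨X, Y, h, ?_⟩
  have hYu := isUnit_det_toRat hY
  -- Since `[X' Y'] = Y' Y⁻¹ [X Y]`, the stable matrix `X' N₀ + Y' D₀` equals `Y' Y⁻¹`, and it is the
  -- inverse of `X N₁ + Y D₁`.
  have hK : K = (toRat Y)⁻¹ * toRat X := by
    rw [hX, Matrix.nonsing_inv_mul_cancel_left _ _ hYu]
  have hX'' : toRat Y' * (toRat Y)⁻¹ * toRat X = toRat X' := by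
    rw [hX', hK, Matrix.mul_assoc]
  have hY'' : toRat Y' * (toRat Y)⁻¹ * toRat Y = toRat Y' :=
    Matrix.nonsing_inv_mul_cancel_right _ _ hYu
  have hV : toRat (X' * N₀ + Y' * D₀) = toRat Y' * (toRat Y)⁻¹ := by
    calc toRat (X' * N₀ + Y' * D₀)
        = toRat Y' * (toRat Y)⁻¹ * toRat (X * N₀ + Y * D₀) := by
          simp only [toRat_add, toRat_mul, mul_add, ← Matrix.mul_assoc, hX'', hY'']
      _ = toRat Y' * (toRat Y)⁻¹ := by rw [h, toRat_one, mul_one]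
  have hVW : (X' * N₀ + Y' * D₀) * (X * N₁ + Y * D₁) = 1 := by
    refine toRat_injective ?_
    rw [toRat_mul, hV, toRat_add, mul_add, toRat_mul, toRat_mul, ← Matrix.mul_assoc, hX'',
      ← Matrix.mul_assoc, hY'', ← toRat_mul, ← toRat_mul, ← toRat_add, h']
  exact Matrix.isUnit_det_of_left_inverse hVW

/-- If `det M` divides all entries of `Δ Adj(M)`, the quotient `[X Y]` solves `[X Y] M = Δ`. -/
theorem exists_fromCols_mul_eq {M : Matrix (Fin m ⊕ Fin m) (Fin m ⊕ Fin m) H}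
    (hd : evalAtInfty M.det ≠ 0) {Δ : Matrix (Fin m) (Fin m ⊕ Fin m) H}
    (h : ∀ i j, M.det ∣ (Δ * M.adjugate) i j) :
    ∃ X Y : Matrix (Fin m) (Fin m) H, Matrix.fromCols X Y * M = Δ := by
  choose Z hZ using h
  have hZ' : M.det • Matrix.of Z = Δ * M.adjugate := by
    refine Matrix.ext fun i j => ?_
    exact (hZ i j).symm
  refine ⟨(Matrix.of Z).toCols₁, (Matrix.of Z).toCols₂, ?_⟩
  rw [Matrix.fromCols_toCols]
  have hne : M.det ≠ 0 := ne_zero_of_evalAtInfty_ne_zero hd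
  refine smul_right_injective _ hne ?_
  simp only
  rw [← Matrix.smul_mul, hZ', Matrix.mul_assoc, Matrix.adjugate_mul, Matrix.mul_smul,
    Matrix.mul_one]

end SimStab

open SimStab Filter Topology in
theorem proposition1 (m : ℕ)
    (P₀ P₁ : Matrix (Fin m) (Fin m) (RatFunc ℝ))
    (N₀ D₀ N₁ D₁ : Matrix (Fin m) (Fin m) SimStab.H)
    (hP₀ : SimStab.IsRightCoprimeRep P₀ N₀ D₀)
    (hP₁ : SimStab.IsRightCoprimeRep P₁ N₁ D₁)
    (M : Matrix (Fin m ⊕ Fin m) (Fin m ⊕ Fin m) SimStab.H)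
    (hM : M = Matrix.fromBlocks N₀ N₁ D₀ D₁)
    (hInfty : SimStab.evalAtInfty M.det ≠ 0)
    (t : ℕ) (s : Fin t → ℂ)
    (hs : Set.range s = {z : ℂ | 0 ≤ z.re ∧ SimStab.evalAt z M.det = 0})
    (hSimple : ∀ i, SimStab.zeroOrder (s i) M.det = 1) :
    (∃ K : Matrix (Fin m) (Fin m) (RatFunc ℝ),
        (∀ i j, SimStab.IsProper (K i j)) ∧
          SimStab.Stabilizes K P₀ ∧ SimStab.Stabilizes K P₁) ↔
      ∃ Δ₀ Δ₁ : Matrix (Fin m) (Fin m) SimStab.H,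
        IsUnit Δ₀.det ∧ IsUnit Δ₁.det ∧
          ∀ i, (Matrix.fromCols Δ₀ Δ₁ * M.adjugate).map (SimStab.evalAt (s i)) = 0 := by
  constructor
  · rintro ⟨K, -, h₀, h₁⟩
    obtain ⟨X, Y, h, hu⟩ := exists_isUnit_det_of_stabilizes hP₀ hP₁ h₀ h₁
    refine ⟨1, X * N₁ + Y * D₁, by simp, hu, fun i => ?_⟩
    obtain ⟨hre, hz⟩ : s i ∈ {z : ℂ | 0 ≤ z.re ∧ evalAt z M.det = 0} :=
      hs ▸ Set.mem_range_self i
    rw [← h, ← Matrix.fromCols_mul_fromBlocks, ← hM, Matrix.mul_assoc, Matrix.mul_adjugate,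
      Matrix.mul_smul, Matrix.mul_one]
    ext a b
    change evalHom (s i) hre (M.det * _) = 0
    rw [map_mul, evalHom_apply, hz, zero_mul]
  · rintro ⟨Δ₀, Δ₁, hΔ₀, hΔ₁, hadj⟩
    obtain ⟨X, Y, hXY⟩ := exists_fromCols_mul_eq hInfty (Δ := Matrix.fromCols Δ₀ Δ₁) fun a b =>
      dvd_of_evalAt_eq_zero hInfty fun z hre hz => by
        obtain ⟨i, rfl⟩ : z ∈ Set.range s := hs ▸ ⟨hre, hz⟩
        exact ⟨(hSimple i).le, congrFun (congrFun (hadj i) a) b⟩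
    rw [hM, Matrix.fromCols_mul_fromBlocks, Matrix.fromCols_ext_iff] at hXY
    obtain ⟨hX₀, hX₁⟩ := hXY
    -- Replacing `Y` by `Y + ε` perturbs `Δᵢ` to `Δᵢ + ε Dᵢ`, which stays unimodular for small `ε`,
    -- and makes `Y` invertible at infinity for all but finitely many `ε`.
    have hev := (eventually_isUnit_det_add hΔ₀ D₀).and (eventually_isUnit_det_add hΔ₁ D₁)
    obtain ⟨ε, ⟨hε₀, hε₁⟩, hε⟩ : ∃ ε : ℝ,
        (IsUnit (Δ₀ + const ε • D₀).det ∧ IsUnit (Δ₁ + const ε • D₁).det) ∧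
          evalAtInfty (Y + const ε • (1 : Matrix (Fin m) (Fin m) H)).det ≠ 0 :=
      ((infinite_of_mem_nhds 0 hev).sdiff (finite_evalAtInfty_det_add_eq_zero Y)).nonempty
    have hY := ne_zero_of_evalAtInfty_ne_zero hε
    have hpert : ∀ {N D Δ : Matrix (Fin m) (Fin m) H}, X * N + Y * D = Δ →
        Δ + const ε • D = X * N + (Y + const ε • 1) * D := by
      rintro N D Δ rfl
      rw [add_mul, Matrix.smul_mul, one_mul, add_assoc]
    rw [hpert hX₀] at hε₀
    rw [hpert hX₁] at hε₁
    exact ⟨_, isProper_inv_mul hε, stabilizes_of_isUnit_det hP₀.1 hP₀.2.2 hY hε₀,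
      stabilizes_of_isUnit_det hP₁.1 hP₁.2.2 hY hε₁⟩
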